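/- **Proposition.** Let $\mathbb B$ be a real separable Banach space of functions $X\to\mathbb R^{d}$ on which all point evaluations are continuous. Let $Y\sim\mathcal{GP}(m,k)$ be an $\mathbb R^d$-valued Gaussian process with index set $X$ on a probability space $(\Omega,\mathcal A,\mathrm P)$ whose paths lie $\mathrm P$-almost surely in $\mathbb B$ and for which $\omega\mapsto Y(\cdot,\omega)$ is a Gaussian random variable with values in $(\mathbb B,\mathcal B(\mathbb B))$. Let $\mathbb H_k$ be the reproducing kernel Hilbert space of the (matrix-valued) covariance function $k$; it is contained in $\mathbb B$. Assume $m\in\mathbb H_k$. Let $\Phi^y:\mathbb B\to\mathbb R$ be norm-continuous and such that for every $\eta>0$ there is $K(\eta)\in\mathbb R$ with $\Phi^y(f)\ge K(\eta)-\eta\|f\|_{\mathbb B}^2$ for all $f\in\mathbb B$. Let $\mathbb F=\{g(\cdot,w): w\in W\}\subset\mathbb B$, $W\subset\mathbb R^p$, be the set of functions represented by a neural network $g$, i.e. by an arbitrary map $(x,w)\mapsto g(x,w)\in\mathbb R^d$ with $g(\cdot,w)\in\mathbb B$ for all $w\in W$. Assume that $\mathbb H_k\cap\mathbb F$ is nonempty,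 that it is closed in $\mathbb B$, that all closed and bounded subsets of $\mathbb H_k\cap\mathbb F$ are compact in $\mathbb B$, and that every $f\in\mathbb H_k$ lying in the $\mathbb B$-closure of $\mathbb F$ belongs to $\mathbb F$ (this last condition holds for instance if $\mathbb F$ is closed in $\mathbb B$). Write $d_{\mathbb B}(f,\mathbb F)=\inf_{f_0\in\mathbb F}\|f_0-f\|_{\mathbb B}$ and, for $\lambda>0$ and $f\in\mathbb H_k$, $$R(f)=\Phi^y(f)+\tfrac12\|f-m\|_{\mathbb H_k}^2,\qquad R^\lambda(f)=\Phi^y(f)+\frac{1}{2\lambda^2}d_{\mathbb B}(f,\mathbb F)^2+\tfrac12\|f-m\|_{\mathbb H_k}^2 .$$ Let $\lambda_n>0$ with $\lambda_n\to0$, and let $f_n^\star\in\mathbb H_k$ be a minimizer of $R^{\lambda_n}$ over $\mathbb H_k$ for each $n$. Then $(f_n^\star)_{n}$ has a subsequence that converges weakly in $\mathbb H_k$ to some $f^\star\in\mathbb H_k\cap\mathbb F$, and this $f^\star$ is a minimizer of $R$ over $\mathbb H_k\cap\mathbb F$. -/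

import Mathlib

open MeasureTheory ProbabilityTheory Filter Topology
open scoped RealInnerProductSpace

noncomputable section

/-- A normed space `B` whose elements are functions `X → V` (the linear map to functions is
injective) and whose point evaluations are continuous. The topology on `X → V` is that of pointwise
convergence, so continuity of `coeCLM` is continuity of every evaluation `b ↦ b x`. -/
class FunctionSpace (B : Type*) (X V : outParam Type*) [NormedAddCommGroup B] [NormedSpace ℝ B]
    [NormedAddCommGroup V] [NormedSpace ℝ V] where
  coeCLM : B →L[ℝ] X → V
  coeCLM_injective : Function.Injective (coeCLM : B → X → V)

instance FunctionSpace.instFunLike {B X V : Type*} [NormedAddCommGroup B] [NormedSpace ℝ B]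
    [NormedAddCommGroup V] [NormedSpace ℝ V] [FunctionSpace B X V] : FunLike B X V where
  coe b := FunctionSpace.coeCLM b
  coe_injective := FunctionSpace.coeCLM_injective

/-- `Y` is a `d`-output Gaussian process on `(Ω, P)` with index set `X`, mean function `m` and
matrix-valued covariance function `k`; its paths lie almost surely in the function space `B`, and
the path map is a Gaussian random variable with values in `B`. -/
structure IsGaussianPrior (B : Type*) {X Ω : Type*} {d : ℕ}
    [NormedAddCommGroup B] [NormedSpace ℝ B] [MeasurableSpace B]
    [FunctionSpace B X (EuclideanSpace ℝ (Fin d))] [MeasurableSpace Ω] (P : Measure Ω)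
    (Y : X → Ω → EuclideanSpace ℝ (Fin d)) (m : X → EuclideanSpace ℝ (Fin d))
    (k : Matrix X X (EuclideanSpace ℝ (Fin d) →L[ℝ] EuclideanSpace ℝ (Fin d))) : Prop where
  isGaussianProcess : IsGaussianProcess Y P
  mean : ∀ x, ∫ ω, Y x ω ∂P = m x
  covariance : ∀ x x' u v, ⟪u, k x x' v⟫ = cov[fun ω ↦ ⟪u, Y x ω⟫, fun ω ↦ ⟪v, Y x' ω⟫; P]
  exists_path : ∃ path : Ω → B, (∀ᵐ ω ∂P, ∀ x, path ω x = Y x ω) ∧ HasGaussianLaw path P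

/-- The reproducing kernel Hilbert space of the covariance function consists of functions that
belong to the path space. -/
theorem IsGaussianPrior.exists_mem_pathSpace {X Ω B H : Type*} {d : ℕ}
    [NormedAddCommGroup B] [NormedSpace ℝ B] [CompleteSpace B] [TopologicalSpace.SeparableSpace B]
    [MeasurableSpace B] [BorelSpace B] [FunctionSpace B X (EuclideanSpace ℝ (Fin d))]
    [MeasurableSpace Ω] {P : Measure Ω}
    {Y : X → Ω → EuclideanSpace ℝ (Fin d)} {m : X → EuclideanSpace ℝ (Fin d)}
    {k : Matrix X X (EuclideanSpace ℝ (Fin d) →L[ℝ] EuclideanSpace ℝ (Fin d))}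
    [NormedAddCommGroup H] [InnerProductSpace ℝ H] [CompleteSpace H]
    [RKHS ℝ H X (EuclideanSpace ℝ (Fin d))]
    (hY : IsGaussianPrior B P Y m k) (hk : RKHS.kernel H = k) (h : H) :
    ∃ b : B, ∀ x, b x = h x := by
  obtain ⟨path, hpath, hG⟩ := hY.exists_path
  have : SecondCountableTopology B := UniformSpace.secondCountable_of_separable B
  have hPP : IsProbabilityMeasure P := hG.isProbabilityMeasure
  let ev : X → B →L[ℝ] EuclideanSpace ℝ (Fin d) := fun x ↦
    (ContinuousLinearMap.proj x).comp (FunctionSpace.coeCLM (B := B))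
  have hev : ∀ x (b : B), ev x b = b x := fun _ _ ↦ rfl
  set μ : B := ∫ ω, path ω ∂P with hμ
  have hpi : Integrable path P := hG.integrable
  have hp2 : MemLp (fun ω ↦ path ω - μ) 2 P := hG.memLp_two.sub (memLp_const μ)
  -- the real random variables `⟪v, Y x - m x⟫`, up to null sets
  let z : X × EuclideanSpace ℝ (Fin d) → Ω → ℝ := fun q ω ↦ ⟪q.2, ev q.1 (path ω - μ)⟫
  have hz : ∀ q, MemLp (z q) 2 P := fun q ↦
    ((innerSL ℝ q.2).comp (ev q.1)).comp_memLp' hp2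
  have hz_cov : ∀ q q', ∫ ω, z q ω * z q' ω ∂P
      = ⟪RKHS.kerFun H q.1 q.2, RKHS.kerFun H q'.1 q'.2⟫ := by
    intro q q'
    rw [real_inner_comm, ← RKHS.kernel_inner, hk, real_inner_comm, hY.covariance]
    have hmean : ∀ r : X × EuclideanSpace ℝ (Fin d),
        ∫ ω, ⟪r.2, Y r.1 ω⟫ ∂P = ⟪r.2, ev r.1 μ⟫ := by
      intro r
      have h1 : (fun ω ↦ ⟪r.2, Y r.1 ω⟫) =ᵐ[P]
          fun ω ↦ ((innerSL ℝ r.2).comp (ev r.1)) (path ω) := by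
        filter_upwards [hpath] with ω hω
        rw [← hω]; rfl
      rw [integral_congr_ae h1, ContinuousLinearMap.integral_comp_comm _ hpi]
      rfl
    rw [ProbabilityTheory.covariance, hmean q, hmean q']
    refine integral_congr_ae ?_
    filter_upwards [hpath] with ω hω
    simp only [z, map_sub, inner_sub_right]
    rw [← hω, ← hω, ← hev, ← hev]
  let A : (X × EuclideanSpace ℝ (Fin d) →₀ ℝ) →ₗ[ℝ] Lp ℝ 2 P :=
    Finsupp.linearCombination ℝ fun q ↦ (hz q).toLp (z q)
  let K : (X × EuclideanSpace ℝ (Fin d) →₀ ℝ) →ₗ[ℝ] H :=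
    Finsupp.linearCombination ℝ fun q ↦ RKHS.kerFun H q.1 q.2
  have hAK1 : ∀ q q', ⟪(hz q).toLp (z q), (hz q').toLp (z q')⟫
      = ⟪RKHS.kerFun H q.1 q.2, RKHS.kerFun H q'.1 q'.2⟫ := by
    intro q q'
    rw [← hz_cov, L2.inner_def]
    refine integral_congr_ae ?_
    filter_upwards [(hz q).coeFn_toLp, (hz q').coeFn_toLp] with ω h1 h2
    rw [h1, h2]
    simp [mul_comm]
  have hAK : ∀ f g, ⟪A f, A g⟫ = ⟪K f, K g⟫ := by
    intro f g
    simp only [A, K, Finsupp.linearCombination_apply, Finsupp.sum_inner, Finsupp.inner_sum,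
      real_inner_smul_left, real_inner_smul_right]
    simp only [hAK1]
  have hnorm : ∀ f, ‖A f‖ = ‖K f‖ := by
    intro f
    have := hAK f f
    rw [real_inner_self_eq_norm_sq, real_inner_self_eq_norm_sq] at this
    exact (sq_eq_sq₀ (norm_nonneg _) (norm_nonneg _)).1 this
  have hdense : h ∈ closure (Set.range K) := by
    have h1 := RKHS.kerFun_dense (𝕜 := ℝ) (H := H)
    have h2 : h ∈ (Submodule.span ℝ {RKHS.kerFun H x v | (x : X) (v)}).topologicalClosure := by
      rw [h1]; trivial
    have h3 : ((Submodule.span ℝ {RKHS.kerFun H x v | (x : X) (v)} : Submodule ℝ H) : Set H)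
        = Set.range K := by
      have h4 : {RKHS.kerFun H x v | (x : X) (v)}
          = Set.range fun q : X × EuclideanSpace ℝ (Fin d) ↦ RKHS.kerFun H q.1 q.2 := by
        ext; simp
      rw [h4, ← Finsupp.range_linearCombination]
      rfl
    rw [← h3]
    exact h2
  obtain ⟨u, hu, hlim⟩ := mem_closure_iff_seq_limit.1 hdense
  choose f hf using hu
  have hcau : CauchySeq fun n ↦ A (f n) := by
    have h1 : CauchySeq u := hlim.cauchySeq
    rw [Metric.cauchySeq_iff] at h1 ⊢
    intro ε hε
    obtain ⟨N, hN⟩ := h1 ε hε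
    refine ⟨N, fun a ha b hb ↦ ?_⟩
    have := hN a ha b hb
    rw [← hf, ← hf, dist_eq_norm, ← map_sub] at this
    rwa [dist_eq_norm, ← map_sub, hnorm]
  obtain ⟨ξ, hξ⟩ := cauchySeq_tendsto_of_complete hcau
  have hmain : ∀ q : X × EuclideanSpace ℝ (Fin d),
      ⟪ξ, (hz q).toLp (z q)⟫ = ⟪h, RKHS.kerFun H q.1 q.2⟫ := by
    intro q
    have h1 := hξ.inner (𝕜 := ℝ) (tendsto_const_nhds (x := (hz q).toLp (z q)))
    have h2 := hlim.inner (𝕜 := ℝ) (tendsto_const_nhds (x := RKHS.kerFun H q.1 q.2))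
    refine tendsto_nhds_unique h1 (h2.congr fun n ↦ ?_)
    have h3 := hAK (f n) (Finsupp.single q 1)
    simp only [A, K, Finsupp.linearCombination_single, one_smul] at h3
    rw [← hf]
    exact h3.symm
  have hint : Integrable (fun ω ↦ ξ ω • (path ω - μ)) P :=
    memLp_one_iff_integrable.1 (hp2.smul (Lp.memLp ξ))
  refine ⟨∫ ω, ξ ω • (path ω - μ) ∂P, fun x ↦ ext_inner_left ℝ fun v ↦ ?_⟩
  have h1 := ContinuousLinearMap.integral_comp_comm ((innerSL ℝ v).comp (ev x)) hint
  have h2 := hmain (x, v)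
  rw [RKHS.inner_kerFun, real_inner_comm, L2.inner_def] at h2
  refine Eq.trans h1.symm (Eq.trans (integral_congr_ae ?_) (h2.trans (real_inner_comm _ _)))
  filter_upwards [(hz (x, v)).coeFn_toLp] with ω h3
  rw [h3]
  simp [z]

/-- The inclusion of the reproducing kernel Hilbert space `H` of the covariance function in the
path space `B`: it sends a function to the same function. -/
def rkhsIncl {X Ω B H : Type*} {d : ℕ}
    [NormedAddCommGroup B] [NormedSpace ℝ B] [CompleteSpace B] [TopologicalSpace.SeparableSpace B]
    [MeasurableSpace B] [BorelSpace B] [FunctionSpace B X (EuclideanSpace ℝ (Fin d))]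
    [MeasurableSpace Ω] {P : Measure Ω}
    {Y : X → Ω → EuclideanSpace ℝ (Fin d)} {m : X → EuclideanSpace ℝ (Fin d)}
    {k : Matrix X X (EuclideanSpace ℝ (Fin d) →L[ℝ] EuclideanSpace ℝ (Fin d))}
    [NormedAddCommGroup H] [InnerProductSpace ℝ H] [CompleteSpace H]
    [RKHS ℝ H X (EuclideanSpace ℝ (Fin d))]
    (hY : IsGaussianPrior B P Y m k) (hk : RKHS.kernel H = k) (h : H) : B :=
  (hY.exists_mem_pathSpace hk h).choose

theorem rkhsIncl_apply {X Ω B H : Type*} {d : ℕ}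
    [NormedAddCommGroup B] [NormedSpace ℝ B] [CompleteSpace B] [TopologicalSpace.SeparableSpace B]
    [MeasurableSpace B] [BorelSpace B] [FunctionSpace B X (EuclideanSpace ℝ (Fin d))]
    [MeasurableSpace Ω] {P : Measure Ω}
    {Y : X → Ω → EuclideanSpace ℝ (Fin d)} {m : X → EuclideanSpace ℝ (Fin d)}
    {k : Matrix X X (EuclideanSpace ℝ (Fin d) →L[ℝ] EuclideanSpace ℝ (Fin d))}
    [NormedAddCommGroup H] [InnerProductSpace ℝ H] [CompleteSpace H]
    [RKHS ℝ H X (EuclideanSpace ℝ (Fin d))]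
    (hY : IsGaussianPrior B P Y m k) (hk : RKHS.kernel H = k) (h : H) (x : X) :
    rkhsIncl hY hk h x = h x :=
  (hY.exists_mem_pathSpace hk h).choose_spec x

/-- The set of functions `net(·, w)`, `w ∈ W`, represented by a neural network, as a subset of the
path space. -/
def networkFunctions (B : Type*) {X V Θ : Type*} [NormedAddCommGroup B] [NormedSpace ℝ B]
    [NormedAddCommGroup V] [NormedSpace ℝ V] [FunctionSpace B X V]
    (net : X → Θ → V) (W : Set Θ) : Set B :=
  {b | ∃ w ∈ W, ∀ x, b x = net x w}

/-- The potential is continuous and bounded below by `K(η) - η ‖b‖²` for every `η > 0`. -/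
structure IsAdmissiblePotential {B : Type*} [NormedAddCommGroup B] (Φ : B → ℝ) : Prop where
  continuous : Continuous Φ
  lower_bound : ∀ η : ℝ, 0 < η → ∃ K : ℝ, ∀ b, K - η * ‖b‖ ^ 2 ≤ Φ b

/-- The assumptions on the function set `F` relative to the Hilbert space `H`, whose inclusion in
the path space `B` is `ι`. The field `closure_inter` says that a function of `H` that is a `B`-limit
of elements of `F` belongs to `F`; it holds, for example, whenever `F` is closed in `B`. -/
structure IsAdmissibleClass {B H : Type*} [NormedAddCommGroup B] (ι : H → B) (F : Set B) :
    Prop where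
  nonempty : (Set.range ι ∩ F).Nonempty
  isClosed : IsClosed (Set.range ι ∩ F)
  heineBorel : ∀ s ⊆ Set.range ι ∩ F, IsClosed s → Bornology.IsBounded s → IsCompact s
  closure_inter : Set.range ι ∩ closure F ⊆ F

/-- The relaxed potential `Φ(b) + d_B(b, F)² / (2 lam²)`. -/
def relaxedPotential {B : Type*} [NormedAddCommGroup B] (Φ : B → ℝ) (F : Set B) (lam : ℝ) (b : B) :
    ℝ :=
  Φ b + 1 / (2 * lam ^ 2) * Metric.infDist b F ^ 2

/-- The objective `f ↦ Φ(f) + ½ ‖f - m‖²_H` on the Hilbert space `H`, for a potential `Φ` on `B`. -/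
def mapObjective {B H : Type*} [NormedAddCommGroup H] (ι : H → B) (m : H) (Φ : B → ℝ) (f : H) : ℝ :=
  Φ (ι f) + 1 / 2 * ‖f - m‖ ^ 2

end

/-! This is the direct method. Comparing `f n` with any competitor `g` in `F`, where the penalty
vanishes, bounds the relaxed objective at `f n` by the unrelaxed one at `g`. Coercivity then bounds
`f n` in `H` and makes the squared distance to `F` at most a constant times `lam n ^ 2`. The key is
that `H` embeds compactly in `B`. With `U` the centred path, a square integrable random vector, each
`h` equals `∫ ξ • U` for some `ξ` with the norm of `h` (`exists_weightedIntegral_eq`), and `ξ ↦ ∫ ξ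
• U` is compact (`isCompactOperator_weightedIntegral`). Hence a subsequence converges weakly in `H`
and in norm in `B` to the same function (`exists_subseq_tendsto_rkhsIncl`). The limit lies in the
closure of `F`, hence in `F`; continuity of `Φ` and weak lower semicontinuity of the norm give
minimality. -/

/-- A bounded sequence in a Hilbert space whose inner products with the members of a total set
converge is weakly convergent. -/
theorem exists_tendsto_inner_of_dense_span {H : Type*} [NormedAddCommGroup H]
    [InnerProductSpace ℝ H] [CompleteSpace H] {S : Set H}
    (hS : (Submodule.span ℝ S).topologicalClosure = ⊤) {u : ℕ → H} {C : ℝ}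
    (hC : ∀ n, ‖u n‖ ≤ C) (hu : ∀ y ∈ S, ∃ l, Tendsto (fun n ↦ ⟪u n, y⟫) atTop (𝓝 l)) :
    ∃ w : H, ∀ y, Tendsto (fun n ↦ ⟪u n, y⟫) atTop (𝓝 ⟪w, y⟫) := by
  let g : ℕ → WeakDual ℝ H := fun n ↦ StrongDual.toWeakDual (innerSL ℝ (u n))
  -- Banach–Alaoglu: in a weak-* compact ball, uniqueness of the cluster point forces the whole
  -- sequence to converge.
  have hK := WeakDual.isCompact_closedBall (𝕜 := ℝ) (0 : StrongDual ℝ H) C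
  have hg : ∀ n, g n ∈ WeakDual.toStrongDual ⁻¹' Metric.closedBall (0 : StrongDual ℝ H) C := by
    intro n
    rw [Set.mem_preimage, mem_closedBall_zero_iff]
    exact (innerSL_apply_norm ℝ (u n)).trans_le (hC n)
  obtain ⟨x, -, hx⟩ := hK.exists_mapClusterPt (f := atTop) (u := g)
    (tendsto_principal.2 (Eventually.of_forall hg))
  have hlim : ∀ x' : WeakDual ℝ H, MapClusterPt x' atTop g → ∀ y ∈ S, ∀ l,
      Tendsto (fun n ↦ ⟪u n, y⟫) atTop (𝓝 l) → x' y = l := by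
    intro x' hx' y _ l hl
    have h1 : MapClusterPt (x' y) atTop (fun n ↦ ⟪u n, y⟫) :=
      hx'.continuousAt_comp (WeakDual.eval_continuous y).continuousAt
    have h2 : (𝓝 (x' y) ⊓ 𝓝 l).NeBot := NeBot.mono h1 (inf_le_inf_left _ hl)
    exact eq_of_nhds_neBot h2
  have huniq : ∀ x' : WeakDual ℝ H, MapClusterPt x' atTop g → x' = x := by
    intro x' hx'
    have hd : Dense (Submodule.span ℝ S : Set H) := by
      rwa [Submodule.dense_iff_topologicalClosure_eq_top]
    have : WeakDual.toStrongDual x' = WeakDual.toStrongDual x :=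
      ContinuousLinearMap.ext_on hd fun y hy ↦ by
        obtain ⟨l, hl⟩ := hu y hy
        exact (hlim x' hx' y hy l hl).trans (hlim x hx y hy l hl).symm
    exact WeakDual.toStrongDual.injective this
  have ht : Tendsto g atTop (𝓝 x) :=
    hK.tendsto_nhds_of_unique_mapClusterPt (Eventually.of_forall hg) fun x' _ hx' ↦ huniq x' hx'
  refine ⟨(InnerProductSpace.toDual ℝ H).symm (WeakDual.toStrongDual x), fun y ↦ ?_⟩
  rw [InnerProductSpace.toDual_symm_apply]
  exact ((WeakDual.eval_continuous y).tendsto x).comp ht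

theorem tendsto_toWeakSpace_of_tendsto_inner {H : Type*} [NormedAddCommGroup H]
    [InnerProductSpace ℝ H] [CompleteSpace H] {u : ℕ → H} {w : H}
    (h : ∀ y, Tendsto (fun n ↦ ⟪u n, y⟫) atTop (𝓝 ⟪w, y⟫)) :
    Tendsto (fun n ↦ toWeakSpace ℝ H (u n)) atTop (𝓝 (toWeakSpace ℝ H w)) := by
  have hinj : Function.Injective (topDualPairing ℝ H).flip := by
    intro a b hab
    refine ext_inner_left ℝ fun v ↦ ?_
    exact LinearMap.congr_fun hab (innerSL ℝ v)
  refine (WeakBilin.tendsto_iff_forall_eval_tendsto _ hinj).2 fun L ↦ ?_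
  have h1 := h ((InnerProductSpace.toDual ℝ H).symm L)
  simp only [real_inner_comm ((InnerProductSpace.toDual ℝ H).symm L),
    InnerProductSpace.toDual_symm_apply] at h1
  exact h1

/-- Two families with the same Gram matrix: every vector approximable by the second family has a
counterpart of the same norm and with the same inner products with respect to the first one. -/
theorem exists_norm_eq_of_gram_eq {ι E H : Type*} [NormedAddCommGroup E]
    [InnerProductSpace ℝ E] [CompleteSpace E] [NormedAddCommGroup H] [InnerProductSpace ℝ H]
    {a : ι → E} {b : ι → H} (hab : ∀ i j, ⟪a i, a j⟫ = ⟪b i, b j⟫) {h : H}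
    (hh : h ∈ (Submodule.span ℝ (Set.range b)).topologicalClosure) :
    ∃ ξ : E, ‖ξ‖ = ‖h‖ ∧ ∀ i, ⟪ξ, a i⟫ = ⟪h, b i⟫ := by
  let A : (ι →₀ ℝ) →ₗ[ℝ] E := Finsupp.linearCombination ℝ a
  let K : (ι →₀ ℝ) →ₗ[ℝ] H := Finsupp.linearCombination ℝ b
  have hAK : ∀ f g, ⟪A f, A g⟫ = ⟪K f, K g⟫ := by
    intro f g
    simp only [A, K, Finsupp.linearCombination_apply, Finsupp.sum_inner, Finsupp.inner_sum,
      real_inner_smul_left, real_inner_smul_right, hab]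
  have hnorm : ∀ f, ‖A f‖ = ‖K f‖ := by
    intro f
    have := hAK f f
    rw [real_inner_self_eq_norm_sq, real_inner_self_eq_norm_sq] at this
    exact (sq_eq_sq₀ (norm_nonneg _) (norm_nonneg _)).1 this
  have hdense : h ∈ closure (Set.range K) := by
    rw [← Finsupp.range_linearCombination] at hh
    exact hh
  obtain ⟨u, hu, hlim⟩ := mem_closure_iff_seq_limit.1 hdense
  choose f hf using hu
  obtain rfl : (fun n ↦ K (f n)) = u := funext hf
  have hcau : CauchySeq fun n ↦ A (f n) := by
    have h1 := hlim.cauchySeq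
    rw [Metric.cauchySeq_iff] at h1 ⊢
    simpa only [dist_eq_norm, ← map_sub, hnorm] using h1
  obtain ⟨ξ, hξ⟩ := cauchySeq_tendsto_of_complete hcau
  refine ⟨ξ, tendsto_nhds_unique (hξ.norm.congr fun n ↦ hnorm (f n)) hlim.norm, fun i ↦ ?_⟩
  refine tendsto_nhds_unique (hξ.inner (𝕜 := ℝ) tendsto_const_nhds)
    ((hlim.inner (𝕜 := ℝ) (tendsto_const_nhds (x := b i))).congr fun n ↦ ?_)
  simpa [A, K] using (hAK (f n) (Finsupp.single i 1)).symm

/-! ### Integral operators with a square integrable kernel -/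

section L2

variable {Ω B : Type*} [MeasurableSpace Ω] {P : Measure Ω} [NormedAddCommGroup B]
  [NormedSpace ℝ B]

theorem integrable_smul_Lp (U : Lp B 2 P) (ξ : Lp ℝ 2 P) :
    Integrable (fun ω ↦ ξ ω • U ω) P :=
  memLp_one_iff_integrable.1 ((Lp.memLp U).smul (Lp.memLp ξ))

variable [CompleteSpace B]

/-- The operator `ξ ↦ ∫ ξ • U` from real to vector-valued random variables, depending linearly on
the square integrable random vector `U`. -/
noncomputable def weightedIntegral (P : Measure Ω) :
    Lp B 2 P →L[ℝ] Lp ℝ 2 P →L[ℝ] B :=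
  (ContinuousLinearMap.lsmul ℝ ℝ : ℝ →L[ℝ] B →L[ℝ] B).flip.lpPairing P 2 2

theorem weightedIntegral_apply (U : Lp B 2 P) (ξ : Lp ℝ 2 P) :
    weightedIntegral P U ξ = ∫ ω, ξ ω • U ω ∂P :=
  ContinuousLinearMap.lpPairing_eq_integral _ _ _

/-- Compact operators form a closed subspace and the operator depends continuously on `U`, so
density reduces to indicators `U = 1_s • c`, for which it has rank at most one. -/
theorem isCompactOperator_weightedIntegral (U : Lp B 2 P) :
    IsCompactOperator (weightedIntegral P U) := by
  refine Lp.induction (by simp) (fun U : Lp B 2 P ↦ IsCompactOperator (weightedIntegral P U))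
    ?_ ?_ ?_ U
  · intro c s hs hμs
    -- The operator factors through `ℝ`, as integration over `s` followed by `t ↦ t • c`.
    have h1 : weightedIntegral P (Lp.simpleFunc.indicatorConst 2 hs hμs.ne c : Lp B 2 P)
        = (ContinuousLinearMap.toSpanSingleton ℝ c).comp
          (weightedIntegral P (indicatorConstLp 2 hs hμs.ne (1 : ℝ))) := by
      ext ξ
      rw [Lp.simpleFunc.coe_indicatorConst, ContinuousLinearMap.comp_apply,
        weightedIntegral_apply, weightedIntegral_apply,
        ← ContinuousLinearMap.integral_comp_comm _ (integrable_smul_Lp _ ξ)]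
      refine integral_congr_ae ?_
      filter_upwards [indicatorConstLp_coeFn (p := 2) (hs := hs) (hμs := hμs.ne) (c := c),
        indicatorConstLp_coeFn (p := 2) (hs := hs) (hμs := hμs.ne) (c := (1 : ℝ))] with ω h2 h3
      rw [h2, h3]
      by_cases hω : ω ∈ s <;> simp [hω]
    rw [h1]
    exact IsCompactOperator.clm_comp (isCompactOperator_of_locallyCompactSpace_dom
      (weightedIntegral P (indicatorConstLp 2 hs hμs.ne (1 : ℝ))))
      (ContinuousLinearMap.toSpanSingleton ℝ c)
  · intro f g hf hg _ h1 h2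
    rw [map_add]
    exact h1.add h2
  · exact isClosed_setOfPred_isCompactOperator.preimage (weightedIntegral P).continuous

/-- Bounded functionals commute with the integral. This turns inner-product identities in `L²` into
point values of `∫ ξ • U`. -/
theorem inner_compLp (L : B →L[ℝ] ℝ) (U : Lp B 2 P) (ξ : Lp ℝ 2 P) :
    ⟪ξ, L.compLp U⟫ = L (weightedIntegral P U ξ) := by
  rw [weightedIntegral_apply, ← L.integral_comp_comm (integrable_smul_Lp U ξ), L2.inner_def]
  refine integral_congr_ae ?_
  filter_upwards [L.coeFn_compLp U] with ω h
  rw [h]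
  simp [mul_comm]

end L2

/-! ### Compact embedding of the reproducing kernel Hilbert space -/

section Prior

variable {X Ω B H : Type*} {d : ℕ}
  [NormedAddCommGroup B] [NormedSpace ℝ B] [CompleteSpace B] [TopologicalSpace.SeparableSpace B]
  [MeasurableSpace B] [BorelSpace B] [FunctionSpace B X (EuclideanSpace ℝ (Fin d))]
  [MeasurableSpace Ω] {P : Measure Ω}
  {Y : X → Ω → EuclideanSpace ℝ (Fin d)} {m : X → EuclideanSpace ℝ (Fin d)}
  {k : Matrix X X (EuclideanSpace ℝ (Fin d) →L[ℝ] EuclideanSpace ℝ (Fin d))}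
  [NormedAddCommGroup H] [InnerProductSpace ℝ H] [CompleteSpace H]
  [RKHS ℝ H X (EuclideanSpace ℝ (Fin d))]

/-- The continuous linear functional `b ↦ ⟪v, b x⟫`. -/
noncomputable def evalInner (B : Type*) {X V : Type*} [NormedAddCommGroup B] [NormedSpace ℝ B]
    [NormedAddCommGroup V] [InnerProductSpace ℝ V] [FunctionSpace B X V] (q : X × V) :
    B →L[ℝ] ℝ :=
  (innerSL ℝ q.2).comp
    ((ContinuousLinearMap.proj (φ := fun _ : X ↦ V) q.1).comp (FunctionSpace.coeCLM (B := B)))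

theorem evalInner_apply {B X V : Type*} [NormedAddCommGroup B] [NormedSpace ℝ B]
    [NormedAddCommGroup V] [InnerProductSpace ℝ V] [FunctionSpace B X V] (q : X × V) (b : B) :
    evalInner B q b = ⟪q.2, b q.1⟫ :=
  rfl

theorem ext_evalInner {B X V : Type*} [NormedAddCommGroup B] [NormedSpace ℝ B]
    [NormedAddCommGroup V] [InnerProductSpace ℝ V] [FunctionSpace B X V] {b b' : B}
    (h : ∀ q, evalInner B q b = evalInner B q b') : b = b' :=
  DFunLike.ext _ _ fun x ↦ ext_inner_left ℝ fun v ↦ h (x, v)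

theorem evalInner_rkhsIncl (hY : IsGaussianPrior B P Y m k) (hk : RKHS.kernel H = k)
    (q : X × EuclideanSpace ℝ (Fin d)) (h : H) :
    evalInner B q (rkhsIncl hY hk h) = ⟪h, RKHS.kerFun H q.1 q.2⟫ := by
  rw [evalInner_apply, rkhsIncl_apply, RKHS.inner_kerFun, real_inner_comm]

theorem span_range_kerFun :
    (Submodule.span ℝ (Set.range fun q : X × EuclideanSpace ℝ (Fin d) ↦
      RKHS.kerFun H q.1 q.2)).topologicalClosure = ⊤ := by
  rw [← RKHS.kerFun_dense (𝕜 := ℝ) (H := H)]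
  congr 2
  ext
  simp

/-- The centred path, as a square integrable random variable in `B`, has the covariance form given
by the kernel. -/
theorem IsGaussianPrior.exists_Lp_inner_compLp (hY : IsGaussianPrior B P Y m k)
    (hk : RKHS.kernel H = k) :
    ∃ U : Lp B 2 P, ∀ q q', ⟪(evalInner B q).compLp U, (evalInner B q').compLp U⟫
      = ⟪RKHS.kerFun H q.1 q.2, RKHS.kerFun H q'.1 q'.2⟫ := by
  obtain ⟨path, hpath, hG⟩ := hY.exists_path
  have : SecondCountableTopology B := UniformSpace.secondCountable_of_separable B
  have hPP : IsProbabilityMeasure P := hG.isProbabilityMeasure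
  set μ : B := ∫ ω, path ω ∂P
  have hp2 : MemLp (fun ω ↦ path ω - μ) 2 P := hG.memLp_two.sub (memLp_const μ)
  refine ⟨hp2.toLp _, fun q q' ↦ ?_⟩
  have hq : ∀ q : X × EuclideanSpace ℝ (Fin d),
      (fun ω ↦ ⟪q.2, Y q.1 ω⟫) =ᵐ[P] fun ω ↦ evalInner B q (path ω) := fun q ↦ by
    filter_upwards [hpath] with ω hω
    rw [evalInner_apply, hω]
  have hmean : ∀ q : X × EuclideanSpace ℝ (Fin d),
      ∫ ω, ⟪q.2, Y q.1 ω⟫ ∂P = evalInner B q μ := fun q ↦ by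
    rw [integral_congr_ae (hq q), ContinuousLinearMap.integral_comp_comm _ hG.integrable]
  rw [real_inner_comm (RKHS.kerFun H q'.1 q'.2), ← RKHS.kernel_inner, hk, real_inner_comm q.2,
    hY.covariance, ProbabilityTheory.covariance, hmean q, hmean q', L2.inner_def]
  refine integral_congr_ae ?_
  filter_upwards [hq q, hq q', hp2.coeFn_toLp, (evalInner B q).coeFn_compLp (hp2.toLp _),
    (evalInner B q').coeFn_compLp (hp2.toLp _)] with ω h1 h2 h3 h4 h5
  rw [h1, h2, h4, h5, h3, map_sub, map_sub]
  simp [mul_comm]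

/-- The inclusion of the reproducing kernel Hilbert space factors norm-preservingly through an
integral operator on square integrable random variables. -/
theorem IsGaussianPrior.exists_weightedIntegral_eq (hY : IsGaussianPrior B P Y m k)
    (hk : RKHS.kernel H = k) :
    ∃ U : Lp B 2 P, ∀ h : H, ∃ ξ : Lp ℝ 2 P, ‖ξ‖ = ‖h‖ ∧
      weightedIntegral P U ξ = rkhsIncl hY hk h := by
  obtain ⟨U, hU⟩ := hY.exists_Lp_inner_compLp hk
  refine ⟨U, fun h ↦ ?_⟩
  obtain ⟨ξ, hξ, hξ'⟩ := exists_norm_eq_of_gram_eq hU (h := h)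
    (by rw [span_range_kerFun]; trivial)
  refine ⟨ξ, hξ, ext_evalInner fun q ↦ ?_⟩
  rw [← inner_compLp, hξ', evalInner_rkhsIncl]

theorem exists_norm_rkhsIncl_le (hY : IsGaussianPrior B P Y m k) (hk : RKHS.kernel H = k) :
    ∃ C : ℝ, ∀ h, ‖rkhsIncl hY hk h‖ ≤ C * ‖h‖ := by
  obtain ⟨U, hU⟩ := hY.exists_weightedIntegral_eq hk
  refine ⟨‖weightedIntegral P U‖, fun h ↦ ?_⟩
  obtain ⟨ξ, hξ, h1⟩ := hU h
  rw [← h1, ← hξ]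
  exact (weightedIntegral P U).le_opNorm ξ

theorem exists_isCompact_rkhsIncl_mem (hY : IsGaussianPrior B P Y m k) (hk : RKHS.kernel H = k)
    (r : ℝ) : ∃ K : Set B, IsCompact K ∧ ∀ h : H, ‖h‖ ≤ r → rkhsIncl hY hk h ∈ K := by
  obtain ⟨U, hU⟩ := hY.exists_weightedIntegral_eq hk
  obtain ⟨K, hK, hK'⟩ := IsCompactOperator.image_closedBall_subset_compact (𝕜₁ := ℝ)
    (f := (weightedIntegral P U : Lp ℝ 2 P →ₗ[ℝ] B)) (isCompactOperator_weightedIntegral U) r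
  refine ⟨K, hK, fun h hr ↦ ?_⟩
  obtain ⟨ξ, hξ, h1⟩ := hU h
  rw [← h1]
  exact hK' ⟨ξ, by rwa [mem_closedBall_zero_iff, hξ], rfl⟩

/-- Every bounded sequence of the reproducing kernel Hilbert space has a subsequence that converges
weakly and whose image in the path space converges in norm. -/
theorem exists_subseq_tendsto_rkhsIncl (hY : IsGaussianPrior B P Y m k) (hk : RKHS.kernel H = k)
    {u : ℕ → H} {r : ℝ} (hr : ∀ n, ‖u n‖ ≤ r) :
    ∃ (φ : ℕ → ℕ) (w : H), StrictMono φ ∧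
      (∀ y, Tendsto (fun j ↦ ⟪u (φ j), y⟫) atTop (𝓝 ⟪w, y⟫)) ∧
      Tendsto (fun j ↦ rkhsIncl hY hk (u (φ j))) atTop (𝓝 (rkhsIncl hY hk w)) := by
  obtain ⟨K, hK, hK'⟩ := exists_isCompact_rkhsIncl_mem hY hk r
  obtain ⟨b, -, φ, hφ, hb⟩ := hK.tendsto_subseq fun n ↦ hK' (u n) (hr n)
  have hq : ∀ q, Tendsto (fun j ↦ ⟪u (φ j), RKHS.kerFun H q.1 q.2⟫) atTop
      (𝓝 (evalInner B q b)) := fun q ↦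
    (((evalInner B q).continuous.tendsto b).comp hb).congr fun j ↦
      evalInner_rkhsIncl hY hk q (u (φ j))
  obtain ⟨w, hw⟩ := exists_tendsto_inner_of_dense_span span_range_kerFun (fun j ↦ hr (φ j)) (by
    rintro _ ⟨q, rfl⟩
    exact ⟨_, hq q⟩)
  -- Point evaluations are continuous for both modes of convergence and separate points of `B`, so
  -- the two limits are the same function.
  have hbw : b = rkhsIncl hY hk w := ext_evalInner fun q ↦ by
    rw [evalInner_rkhsIncl]
    exact tendsto_nhds_unique (hq q) (hw _)
  exact ⟨φ, w, hφ, hw, hbw ▸ hb⟩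

end Prior

/-! ### Coercivity and passage to the limit -/

theorem le_relaxedPotential {B : Type*} [NormedAddCommGroup B] (Φ : B → ℝ) (F : Set B) (lam : ℝ)
    (b : B) : Φ b ≤ relaxedPotential Φ F lam b :=
  le_add_of_nonneg_right (by positivity)

theorem relaxedPotential_of_mem {B : Type*} [NormedAddCommGroup B] (Φ : B → ℝ) {F : Set B}
    (lam : ℝ) {b : B} (hb : b ∈ F) : relaxedPotential Φ F lam b = Φ b := by
  simp [relaxedPotential, Metric.infDist_zero_of_mem hb]

/-- An admissible potential composed with a map of linear growth is absorbed by the quadratic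
penalty. -/
theorem IsAdmissiblePotential.exists_le_mapObjective {B H : Type*} [NormedAddCommGroup B]
    [NormedAddCommGroup H] {Φ : B → ℝ} (hΦ : IsAdmissiblePotential Φ) {ι : H → B} {C : ℝ}
    (hι : ∀ h, ‖ι h‖ ≤ C * ‖h‖) (m : H) :
    ∃ K : ℝ, ∀ h, K + 1 / 4 * ‖h - m‖ ^ 2 ≤ mapObjective ι m Φ h := by
  -- With this `η` the loss is at most `‖h‖ ^ 2 / 8`, hence at most `(‖h - m‖ ^ 2 + ‖m‖ ^ 2) / 4`:
  -- half of the quadratic penalty survives. The `+ 1` keeps the denominator positive when `C = 0`.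
  obtain ⟨K, hK⟩ := hΦ.lower_bound (1 / (8 * (C ^ 2 + 1))) (by positivity)
  refine ⟨K - 1 / 4 * ‖m‖ ^ 2, fun h ↦ ?_⟩
  have h1 : ‖ι h‖ ^ 2 ≤ (C ^ 2 + 1) * ‖h‖ ^ 2 := by
    have := pow_le_pow_left₀ (norm_nonneg _) (hι h) 2
    nlinarith [sq_nonneg ‖h‖]
  have h2 : 1 / (8 * (C ^ 2 + 1)) * ‖ι h‖ ^ 2 ≤ 1 / 8 * ‖h‖ ^ 2 := by
    calc 1 / (8 * (C ^ 2 + 1)) * ‖ι h‖ ^ 2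
        ≤ 1 / (8 * (C ^ 2 + 1)) * ((C ^ 2 + 1) * ‖h‖ ^ 2) := by gcongr
      _ = 1 / 8 * ‖h‖ ^ 2 := by field_simp
  have h3 : ‖h‖ ≤ ‖h - m‖ + ‖m‖ := norm_le_norm_sub_add h m
  have h4 : ‖h‖ ^ 2 ≤ 2 * ‖h - m‖ ^ 2 + 2 * ‖m‖ ^ 2 := by
    have := pow_le_pow_left₀ (norm_nonneg _) h3 2
    nlinarith [sq_nonneg (‖h - m‖ - ‖m‖)]
  have h5 := hK (ι h)
  unfold mapObjective
  linarith

theorem mainTheorem2 {X Ω B H : Type*} {d p : ℕ}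
    [NormedAddCommGroup B] [NormedSpace ℝ B] [CompleteSpace B] [TopologicalSpace.SeparableSpace B]
    [MeasurableSpace B] [BorelSpace B] [FunctionSpace B X (EuclideanSpace ℝ (Fin d))]
    [MeasurableSpace Ω] (P : Measure Ω)
    (Y : X → Ω → EuclideanSpace ℝ (Fin d))
    (k : Matrix X X (EuclideanSpace ℝ (Fin d) →L[ℝ] EuclideanSpace ℝ (Fin d)))
    [NormedAddCommGroup H] [InnerProductSpace ℝ H] [CompleteSpace H]
    [RKHS ℝ H X (EuclideanSpace ℝ (Fin d))]
    (hk : RKHS.kernel H = k) (m : H) (hY : IsGaussianPrior B P Y m k)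
    (Φ : B → ℝ) (hΦ : IsAdmissiblePotential Φ)
    (net : X → EuclideanSpace ℝ (Fin p) → EuclideanSpace ℝ (Fin d))
    (W : Set (EuclideanSpace ℝ (Fin p)))
    (hnet : ∀ w ∈ W, ∃ b : B, ∀ x, b x = net x w)
    (hF : IsAdmissibleClass (rkhsIncl hY hk) (networkFunctions B net W))
    (lam : ℕ → ℝ) (hlam_pos : ∀ n, 0 < lam n) (hlam : Tendsto lam atTop (𝓝 0))
    (f : ℕ → H)
    (hf : ∀ n, IsMinOn (mapObjective (rkhsIncl hY hk) m
      (relaxedPotential Φ (networkFunctions B net W) (lam n))) Set.univ (f n)) :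
    ∃ (φ : ℕ → ℕ) (fstar : H), StrictMono φ ∧
      Tendsto (fun j ↦ toWeakSpace ℝ H (f (φ j))) atTop (𝓝 (toWeakSpace ℝ H fstar)) ∧
      rkhsIncl hY hk fstar ∈ networkFunctions B net W ∧
      IsMinOn (mapObjective (rkhsIncl hY hk) m Φ)
        {g : H | rkhsIncl hY hk g ∈ networkFunctions B net W} fstar := by
  set ι := rkhsIncl hY hk
  set F := networkFunctions B net W
  obtain ⟨_, ⟨f₀, rfl⟩, hf₀⟩ := hF.nonempty
  obtain ⟨C, hC⟩ := exists_norm_rkhsIncl_le hY hk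
  obtain ⟨K, hK⟩ := hΦ.exists_le_mapObjective hC m
  have hmin : ∀ g, ι g ∈ F → ∀ n,
      mapObjective ι m (relaxedPotential Φ F (lam n)) (f n) ≤ mapObjective ι m Φ g := by
    intro g hg n
    refine (hf n (Set.mem_univ g)).trans_eq ?_
    simp only [mapObjective, relaxedPotential_of_mem Φ (lam n) hg]
  set M := mapObjective ι m Φ f₀ - K with hM
  have hsplit : ∀ n, 1 / 4 * ‖f n - m‖ ^ 2
      + 1 / (2 * lam n ^ 2) * Metric.infDist (ι (f n)) F ^ 2 ≤ M := by
    intro n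
    have h1 := hmin f₀ hf₀ n
    have h2 := hK (f n)
    simp only [mapObjective, relaxedPotential] at h1 h2 hM
    linarith
  have hbound : ∀ n, ‖f n‖ ≤ (4 * M + 1) + ‖m‖ := by
    intro n
    have h1 : 0 ≤ 1 / (2 * lam n ^ 2) * Metric.infDist (ι (f n)) F ^ 2 := by positivity
    -- From `t ≤ t ^ 2 + 1 / 4` and `t ^ 2 ≤ 4 * M`, which avoids a square root.
    have h2 : ‖f n - m‖ ≤ 4 * M + 1 := by
      nlinarith [hsplit n, sq_nonneg (‖f n - m‖ - 1 / 2)]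
    linarith [norm_le_norm_sub_add (f n) m]
  have hdist : Tendsto (fun n ↦ Metric.infDist (ι (f n)) F ^ 2) atTop (𝓝 0) := by
    have h1 : Tendsto (fun n ↦ 2 * lam n ^ 2 * M) atTop (𝓝 0) := by
      simpa using ((hlam.pow 2).const_mul 2).mul_const M
    refine squeeze_zero (fun n ↦ sq_nonneg _) (fun n ↦ ?_) h1
    have h2 : 1 / (2 * lam n ^ 2) * Metric.infDist (ι (f n)) F ^ 2 ≤ M := by
      linarith [hsplit n, sq_nonneg ‖f n - m‖]
    have h3 : 0 < 2 * lam n ^ 2 := by have := hlam_pos n; positivity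
    rwa [one_div, inv_mul_le_iff₀ h3] at h2
  obtain ⟨φ, w, hφ, hw, hιw⟩ := exists_subseq_tendsto_rkhsIncl hY hk hbound
  have hwF : ι w ∈ F := by
    refine hF.closure_inter ⟨⟨w, rfl⟩, ?_⟩
    rw [Metric.mem_closure_iff_infDist_zero ⟨_, hf₀⟩]
    have h1 := (((Metric.continuous_infDist_pt F).tendsto (ι w)).comp hιw).pow 2
    exact pow_eq_zero_iff two_ne_zero |>.1
      (tendsto_nhds_unique h1 (hdist.comp hφ.tendsto_atTop))
  refine ⟨φ, w, hφ, tendsto_toWeakSpace_of_tendsto_inner hw, hwF, fun g hg ↦ ?_⟩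
  -- Weak lower semicontinuity by hand: `½‖f - m‖²` is replaced by its tangent at `w`, the minorant
  -- `⟪f - m, w - m⟫ - ½‖w - m‖²`, which is weakly continuous in `f` and exact at `f = w`.
  have h1 : Tendsto (fun j ↦ Φ (ι (f (φ j))) + (⟪f (φ j), w - m⟫ - ⟪m, w - m⟫)
      - 1 / 2 * ‖w - m‖ ^ 2) atTop
      (𝓝 (Φ (ι w) + (⟪w, w - m⟫ - ⟪m, w - m⟫) - 1 / 2 * ‖w - m‖ ^ 2)) :=
    (((hΦ.continuous.tendsto _).comp hιw).add ((hw _).sub_const _)).sub_const _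
  have h2 := le_of_tendsto' h1 (b := mapObjective ι m Φ g) fun j ↦ by
    refine le_trans ?_ (hmin g hg (φ j))
    have h3 := le_relaxedPotential Φ F (lam (φ j)) (ι (f (φ j)))
    have h4 := norm_sub_sq_real (f (φ j) - m) (w - m)
    rw [inner_sub_left] at h4
    have h5 := sq_nonneg ‖f (φ j) - m - (w - m)‖
    unfold mapObjective
    linarith
  rw [← inner_sub_left, real_inner_self_eq_norm_sq] at h2
  change mapObjective ι m Φ w ≤ mapObjective ι m Φ g
  have h3 : mapObjective ι m Φ w = Φ (ι w) + 1 / 2 * ‖w - m‖ ^ 2 := rfl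
  linarith
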